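/- There is an absolute constant $c>0$ with the following property. For every integer $N>1$ there is a permutation $\sigma$ of $\{1,2,\dots,N\}$ such that the maximal operator $$T_{\sigma,N}f(x)=\max_{1\le m\le N}\left|\sum_{k=1}^{m}c_{\sigma(k)}e^{2\pi i\sigma(k)x}\right|,\qquad c_k=\int_{\mathbb T}f(x)e^{-2\pi ikx}\,dx,$$ acting on complex-valued functions $f\in L^2(\mathbb T)$, $\mathbb T=\mathbb R/\mathbb Z$, satisfies $$\|T_{\sigma,N}\|_{L^2\to L^{2,\infty}}:=\sup_{\|f\|_2\le 1,\ \lambda>0}\lambda\,\bigl|\{x\in\mathbb T:\ |T_{\sigma,N}f(x)|>\lambda\}\bigr|^{1/2}\ \ge\ c\,\sqrt{\log N}.$$ -/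

import Mathlib

open scoped ENNReal

noncomputable section

/-- The torus `ℝ / ℤ` carries the normalized Haar (Lebesgue) measure `AddCircle.haarAddCircle`;
this is the space of (classes of) square integrable complex functions on it. -/
abbrev TorusL2 : Type :=
  MeasureTheory.Lp ℂ 2 (AddCircle.haarAddCircle (T := (1 : ℝ)))

/-- The partial sum `∑_{k=1}^m c_{σ(k)} e^{2πiσ(k)x}` of the rearranged Fourier series of `f`,
where `σ` is a permutation of `{1, …, N}` and `c_n` is the `n`-th Fourier coefficient of `f`. -/
def rearrangedPartialSum {N : ℕ} (σ : Equiv.Perm (Finset.Icc 1 N)) (f : TorusL2)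
    (m : Finset.Icc 1 N) (x : UnitAddCircle) : ℂ :=
  ∑ k : Finset.Icc 1 N with k ≤ m,
    fourierCoeff (f : UnitAddCircle → ℂ) ((σ k : ℕ) : ℤ) * fourier ((σ k : ℕ) : ℤ) x

/-- The maximal operator `T_{σ,N} f (x) = max_{1 ≤ m ≤ N} |∑_{k=1}^m c_{σ(k)} e^{2πiσ(k)x}|`. -/
def rearrangedMaximal {N : ℕ} (σ : Equiv.Perm (Finset.Icc 1 N)) (f : TorusL2)
    (x : UnitAddCircle) : ℝ :=
  ⨆ m : Finset.Icc 1 N, ‖rearrangedPartialSum σ f m x‖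

/-- The weak-type norm
`‖T‖_{L² → L^{2,∞}} = sup_{‖f‖₂ ≤ 1, lam > 0} lam * |{x : |T f (x)| > lam}|^{1/2}`,
as an element of `[0, ∞]`. -/
def weakL2Norm (T : TorusL2 → UnitAddCircle → ℝ) : ℝ≥0∞ :=
  ⨆ (f : TorusL2) (_ : ‖f‖ ≤ 1) (lam : ℝ) (_ : 0 < lam),
    ENNReal.ofReal lam *
      (AddCircle.haarAddCircle (T := (1 : ℝ)) {x | lam < |T f x|}) ^ (1 / 2 : ℝ)

end

/-! Take a binary tree of depth `n` and give each node `v` its own coordinate θ_v on a torus. The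
half circles containing the coordinates choose a branch: upper means "turn right". Let F_v(θ) be
e^{2πiθ_v} if `v` lies on this branch and 0 otherwise. In the in-order numbering, the branch nodes
before the end of the branch are exactly those where it turns right, and there Im F_v ≥ 0. So an
in-order partial sum of the F_v, cut at a place depending on θ, collects all the positive parts
along the branch. Their sum has mean n/π and is at most n, so it is of order n on a set of measure
bounded below. The spectra of the F_v are disjoint and Σ‖F_v‖² = n, which gives a gain of √n
(`exists_minorant_le_norm`, `le_integral_minorant`, `eq_of_prod_fourierCoeff_ne_zero`).

It remains to reach the circle with frequencies at most exponential in n, so that n is comparable to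
log N. Since Fourier coefficients of half circles decay like 1/|r|, each F_v is exponentially close
in L² to a part of its Fourier series with exponentially many terms and exponentially bounded
frequencies (`exists_sparse_approx`). A vector m of exponential size separates these frequencies
(`exists_injOn_linear`), so along x ↦ φ + m x they become distinct integers; a suitable φ keeps the
mean (`exists_phase`). Sorting these integers by the rank of their node gives σ. -/

open MeasureTheory

/-! ### In-order binary trees. -/

/-- A complete binary tree of depth `n` on the nodes `V`. `anc v` is the set of proper ancestors of
`v`, `side v a` tells whether `v` lies in the right subtree of its ancestor `a`, and `rank` is the
in-order numbering. A choice `b` of a child at every node singles out a branch, and the end of the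
branch sits at a point `t` of the in-order numbering. -/
structure InorderTree (V : Type) (n : ℕ) where
  anc : V → Finset V
  side : V → V → Bool
  rank : V → ℝ
  card_anc_le : ∀ v, (anc v).card ≤ n
  anc_asymm : ∀ v a, a ∈ anc v → v ∉ anc a
  branch : ∀ b : V → Bool, ∃ t : ℝ, 0 < t ∧ t ≤ 1 ∧
    ∀ v, (∀ a ∈ anc v, b a = side v a) → (rank v < t ↔ b v = true)

namespace InorderTree

variable {V : Type} {n : ℕ}

/-- The node `v` lies on the branch singled out by `b`. -/
def Active (T : InorderTree V n) (b : V → Bool) (v : V) : Prop :=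
  ∀ a ∈ T.anc v, b a = T.side v a

theorem not_mem_anc_self (T : InorderTree V n) (v : V) : v ∉ T.anc v := fun h =>
  T.anc_asymm v v h h

/-- Two copies of a tree of depth `n`, joined by a root. -/
noncomputable def succ (T : InorderTree V n) : InorderTree (Option (Bool × V)) (n + 1) where
  anc := fun
    | none => ∅
    | some (c, v) => Finset.cons none
        ((T.anc v).map ((Function.Embedding.sectR c V).trans Function.Embedding.some)) (by simp)
  side := fun
    | some (_, v), some (_, a) => T.side v a
    | some (c, _), none => c
    -- Only values of `side` at genuine ancestors matter; the root has none, so this value is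
    -- arbitrary.
    | none, _ => true
  rank := fun
    | none => 1 / 2
    | some (c, v) => (T.rank v + if c then 1 else 0) / 2
  card_anc_le := by
    rintro (_ | ⟨c, v⟩)
    · simp
    · simpa using T.card_anc_le v
  anc_asymm := by
    rintro (_ | ⟨c, v⟩) (_ | ⟨c', a⟩) h
    · simp at h
    · simp at h
    · simp
    · simp only [Finset.mem_cons, reduceCtorEq, Finset.mem_map, Function.Embedding.trans_apply,
        Function.Embedding.sectR_apply, Function.Embedding.some_apply, Option.some.injEq, Prod.mk.injEq, false_or, not_exists, not_and] at h ⊢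
      obtain ⟨a', h1, h2, rfl⟩ := h
      rintro v' hv' - rfl
      exact T.anc_asymm _ _ h1 hv'
  branch := by
    intro b
    obtain ⟨t, h0, h1, ht⟩ := T.branch (fun v => b (some (b none, v)))
    -- Since 0 < t ≤ 1, the new end is > 1/2 after a right turn and ≤ 1/2 after a left turn, which
    -- is the strict comparison required at the root.
    refine ⟨(t + if b none then 1 else 0) / 2, ?_, ?_, ?_⟩
    · split_ifs <;> linarith
    · split_ifs <;> linarith
    rintro (_ | ⟨c, v⟩) hv
    · cases h : b none
      · simp only [Bool.false_eq_true, if_false, iff_false]; linarith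
      · simp only [if_true, iff_true]; linarith
    · have hc : b none = c := hv none (by simp)
      subst hc
      rw [← ht v (fun a ha => hv (some (b none, a)) (by simpa using ha))]
      constructor <;> intro h <;> linarith

theorem active_succ_some (T : InorderTree V n) (b : Option (Bool × V) → Bool) (c : Bool) (v : V) :
    T.succ.Active b (some (c, v)) ↔
      b none = c ∧ T.Active (fun v => b (some (c, v))) v := by
  simp [Active, succ]

end InorderTree

open Classical in
/-- Complete binary trees exist, with `2 ^ n - 1` nodes, such that the nodes of each level carry
total mass `1` and every branch has at most `n` nodes. -/
theorem exists_inorderTree (n : ℕ) : ∃ (V : Type) (_ : Fintype V) (T : InorderTree V n),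
    Fintype.card V + 1 = 2 ^ n ∧ ∑ v, (1 / 2 : ℝ) ^ (T.anc v).card = n ∧
    ∀ b : V → Bool, (Finset.univ.filter (T.Active b)).card ≤ n := by
  induction n with
  | zero =>
    refine ⟨Empty, inferInstance, ⟨fun v => v.elim, fun v => v.elim, fun v => v.elim,
      fun v => v.elim, fun v => v.elim, fun b => ⟨1, by simp⟩⟩, by simp, by simp, by simp⟩
  | succ n ih =>
    obtain ⟨V, _, T, h1, h2, h3⟩ := ih
    refine ⟨Option (Bool × V), inferInstance, T.succ, ?_, ?_, ?_⟩
    · simp [pow_succ, ← h1]; ring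
    · have h : ∀ c v, (T.succ.anc (some (c, v))).card = (T.anc v).card + 1 := by
        intro c v; simp [InorderTree.succ]
      have h0 : (T.succ.anc none).card = 0 := by simp [InorderTree.succ]
      rw [Fintype.sum_option, Fintype.sum_prod_type]
      simp only [h, h0, pow_succ, ← Finset.sum_mul, h2]
      simp; ring
    · intro b
      have hsub : Finset.univ.filter (T.succ.Active b) ⊆ insert none
          ((Finset.univ.filter (T.Active (fun v => b (some (b none, v))))).image
            (fun v => some (b none, v))) := by
        rintro (_ | ⟨c, v⟩) hv
        · simp
        · rw [Finset.mem_filter, InorderTree.active_succ_some] at hv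
          obtain ⟨-, rfl, hv⟩ := hv
          simp [hv]
      refine (Finset.card_le_card hsub).trans ((Finset.card_insert_le _ _).trans ?_)
      exact Nat.succ_le_succ (Finset.card_image_le.trans (h3 _))

/-! ### Separating frequency vectors by a small linear form. -/

/-- Finitely many integer vectors are separated by a linear form with small coefficients. -/
theorem exists_injOn_linear {V : Type*} [Fintype V] (U : Finset (V → ℤ)) :
    ∃ m : V → ℕ, (∀ v, m v ≤ U.card ^ 2) ∧
      Set.InjOn (fun L : V → ℤ => ∑ v, L v * (m v : ℤ)) U := by
  classical
  -- P is the product of the linear forms ⟨L - L', X⟩ over pairs L ≠ L'. It is nonzero of degree at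
  -- most |U|², so it cannot vanish on a grid with |U|² + 1 values per coordinate.
  set P : MvPolynomial V ℤ := ∏ p ∈ U.offDiag, ∑ v, MvPolynomial.monomial (Finsupp.single v 1)
    (p.1 v - p.2 v) with hP
  have hP0 : P ≠ 0 := by
    refine Finset.prod_ne_zero_iff.2 fun p hp h => (Finset.mem_offDiag.1 hp).2.2 ?_
    funext v
    have := congrArg (MvPolynomial.coeff (Finsupp.single v 1)) h
    simp only [MvPolynomial.coeff_sum, MvPolynomial.coeff_monomial, MvPolynomial.coeff_zero,
      Finsupp.single_left_inj one_ne_zero, Finset.sum_ite_eq', Finset.mem_univ, if_true] at this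
    linarith
  have hdeg : P.totalDegree ≤ U.card ^ 2 := by
    refine (MvPolynomial.totalDegree_finsetProd _ _).trans ?_
    calc _ ≤ ∑ p ∈ U.offDiag, 1 := Finset.sum_le_sum fun p _ => by
            refine MvPolynomial.totalDegree_finsetSum_le fun v _ => ?_
            refine (MvPolynomial.totalDegree_monomial_le _ _).trans ?_
            simp
      _ ≤ _ := by
        rw [Finset.sum_const, smul_eq_mul, mul_one, Finset.offDiag_card, sq]
        exact Nat.sub_le _ _
  have hex : ∃ x : V → ℤ, (∀ v, x v ∈ (Finset.range (U.card ^ 2 + 1)).image (Nat.cast : ℕ → ℤ)) ∧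
      MvPolynomial.eval x P ≠ 0 := by
    by_contra! h
    refine hP0 (MvPolynomial.eq_zero_of_eval_zero_at_prod_finset P
      (fun _ => (Finset.range (U.card ^ 2 + 1)).image (Nat.cast : ℕ → ℤ)) (fun v => ?_) h)
    rw [Finset.card_image_of_injective _ Nat.cast_injective, Finset.card_range]
    exact Nat.lt_succ_of_le ((MvPolynomial.degreeOf_le_totalDegree _ _).trans hdeg)
  obtain ⟨x, hx, hne⟩ := hex
  simp only [Finset.mem_image, Finset.mem_range] at hx
  choose m hm hmx using hx
  refine ⟨m, fun v => Nat.lt_succ_iff.1 (hm v), fun L hL L' hL' h => ?_⟩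
  by_contra hLL
  rw [hP, map_prod, Finset.prod_ne_zero_iff] at hne
  refine hne (L, L') (Finset.mem_offDiag.2 ⟨hL, hL', hLL⟩) ?_
  simp only [map_sum, MvPolynomial.eval_monomial, ← hmx]
  simp only [pow_zero, Finsupp.prod_single_index, pow_one, sub_mul, Finset.sum_sub_distrib]
  exact sub_eq_zero.2 h

/-! ### Rearranged partial sums and the weak norm. -/

/-- The integers from `1` to `N` can be sorted by any real key. -/
theorem exists_perm_monotone (N : ℕ) (key : ℕ → ℝ) :
    ∃ σ : Equiv.Perm (Finset.Icc 1 N), Monotone fun k => key (σ k) := by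
  let e : Fin N ≃o Finset.Icc 1 N := Finset.orderIsoOfFin _ (by simp)
  refine ⟨(e.symm.toEquiv.trans (Tuple.sort fun i => key (e i))).trans e.toEquiv, ?_⟩
  intro k l hkl
  exact Tuple.monotone_sort (fun i => key (e i)) (e.symm.monotone hkl)

theorem rearrangedMaximal_nonneg {N : ℕ} (σ : Equiv.Perm (Finset.Icc 1 N)) (f : TorusL2)
    (x : UnitAddCircle) : 0 ≤ rearrangedMaximal σ f x :=
  Real.iSup_nonneg fun _ => norm_nonneg _

theorem norm_rearrangedPartialSum_le {N : ℕ} (σ : Equiv.Perm (Finset.Icc 1 N)) (f : TorusL2)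
    (m : Finset.Icc 1 N) (x : UnitAddCircle) :
    ‖rearrangedPartialSum σ f m x‖ ≤ rearrangedMaximal σ f x :=
  le_ciSup (f := fun m => ‖rearrangedPartialSum σ f m x‖) (Set.finite_range _).bddAbove m

/-- If `σ` sorts the frequencies by `key`, then the sums over `key j < t` are partial sums. -/
theorem norm_sum_key_lt_le {N : ℕ} {key : ℕ → ℝ} {σ : Equiv.Perm (Finset.Icc 1 N)}
    (hσ : Monotone fun k => key (σ k)) (f : TorusL2) (x : UnitAddCircle) (t : ℝ) :
    ‖∑ j ∈ Finset.Icc 1 N with key j < t,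
      fourierCoeff (f : UnitAddCircle → ℂ) (j : ℤ) * fourier (j : ℤ) x‖ ≤
      rearrangedMaximal σ f x := by
  classical
  have hsum : ∑ j ∈ Finset.Icc 1 N with key j < t,
      fourierCoeff (f : UnitAddCircle → ℂ) (j : ℤ) * fourier (j : ℤ) x =
      ∑ k : Finset.Icc 1 N with key (σ k) < t,
        fourierCoeff (f : UnitAddCircle → ℂ) ((σ k : ℕ) : ℤ) * fourier ((σ k : ℕ) : ℤ) x := by
    rw [Finset.sum_filter, Finset.sum_filter, ← Finset.sum_coe_sort (Finset.Icc 1 N)]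
    exact (Equiv.sum_comp σ (fun j : Finset.Icc 1 N => if key j < t then
      fourierCoeff (f : UnitAddCircle → ℂ) ((j : ℕ) : ℤ) * fourier ((j : ℕ) : ℤ) x else 0)).symm
  rw [hsum]
  rcases (Finset.univ.filter fun k : Finset.Icc 1 N => key (σ k) < t).eq_empty_or_nonempty
    with h | h
  · rw [h, Finset.sum_empty, norm_zero]
    exact rearrangedMaximal_nonneg _ _ _
  -- By monotonicity the indices with key below `t` form an initial segment, ending at their
  -- maximum. The empty segment is treated apart because m starts at 1.
  · convert norm_rearrangedPartialSum_le σ f (Finset.max' _ h) x using 2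
    refine Finset.sum_congr (Finset.ext fun k => ?_) fun _ _ => rfl
    simp only [Finset.mem_filter, Finset.mem_univ, true_and]
    refine ⟨fun hk => Finset.le_max' _ _ (by simpa using hk), fun hk => ?_⟩
    have hm := Finset.max'_mem _ h
    rw [Finset.mem_filter] at hm
    exact (hσ hk).trans_lt hm.2

/-- The trigonometric polynomial with given coefficients, as an element of `L²`. -/
noncomputable def trigPolyL2 (U : Finset ℤ) (c : ℤ → ℂ) : TorusL2 :=
  ∑ k ∈ U, c k • fourierLp 2 k

theorem fourierCoeff_trigPolyL2 (U : Finset ℤ) (c : ℤ → ℂ) (j : ℤ) :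
    fourierCoeff (trigPolyL2 U c : UnitAddCircle → ℂ) j = if j ∈ U then c j else 0 := by
  rw [← fourierBasis_repr, HilbertBasis.repr_apply_apply, coe_fourierBasis, trigPolyL2]
  split_ifs with h
  · exact orthonormal_fourier.inner_right_sum c h
  · rw [inner_sum]
    refine Finset.sum_eq_zero fun k hk => ?_
    rw [inner_smul_right, orthonormal_fourier.inner_eq_zero (by rintro rfl; exact h hk), mul_zero]

theorem norm_trigPolyL2_sq (U : Finset ℤ) (c : ℤ → ℂ) :
    ‖trigPolyL2 U c‖ ^ 2 = ∑ k ∈ U, ‖c k‖ ^ 2 := by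
  have h := orthonormal_fourier (T := (1 : ℝ)).inner_sum c c U
  have h2 := inner_self_eq_norm_sq_to_K (𝕜 := ℂ) (trigPolyL2 U c)
  rw [trigPolyL2, h] at h2
  have h3 : ((∑ k ∈ U, ‖c k‖ ^ 2 : ℝ) : ℂ) = ((‖trigPolyL2 U c‖ ^ 2 : ℝ) : ℂ) := by
    push_cast
    rw [trigPolyL2]
    refine Eq.trans (Finset.sum_congr rfl fun k _ => ?_) h2
    rw [mul_comm, Complex.mul_conj, Complex.normSq_eq_norm_sq]
    push_cast; rfl
  exact_mod_cast h3.symm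

/-- A lower bound of the weak norm by a trigonometric polynomial whose frequencies `κ p` are sorted
by the rank of their index `p`. -/
theorem exists_perm_le_weakL2Norm {ι : Type*} (N : ℕ) (U : Finset ι) (κ : ι → ℕ)
    (hκ : Set.InjOn κ U) (hN : ∀ p ∈ U, κ p ∈ Finset.Icc 1 N) (r : ι → ℝ) (c : ι → ℂ)
    {D lam δ : ℝ} (hD : 0 < D) (hcD : ∑ p ∈ U, ‖c p‖ ^ 2 ≤ D) (hlam : 0 < lam) (hδ : 0 ≤ δ)
    {X : Set UnitAddCircle} (hX : ENNReal.ofReal δ ≤ AddCircle.haarAddCircle (T := (1 : ℝ)) X)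
    (hXt : ∀ x ∈ X, ∃ t, lam < ‖∑ p ∈ U with r p < t, c p * fourier (κ p : ℤ) x‖) :
    ∃ σ : Equiv.Perm (Finset.Icc 1 N),
      ENNReal.ofReal (lam / Real.sqrt D * Real.sqrt δ) ≤ weakL2Norm (rearrangedMaximal σ) := by
  classical
  rcases U.eq_empty_or_nonempty with rfl | ⟨p₀, hp₀⟩
  · have hX0 : X = ∅ := by
      refine Set.eq_empty_of_forall_notMem fun x hx => ?_
      obtain ⟨t, ht⟩ := hXt x hx
      simp at ht
      linarith
    rw [hX0, MeasureTheory.measure_empty, nonpos_iff_eq_zero, ENNReal.ofReal_eq_zero] at hX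
    refine ⟨1, ?_⟩
    simp [Real.sqrt_eq_zero_of_nonpos hX]
  have : Nonempty ι := ⟨p₀⟩
  -- Off the image of `U` the value of `inv`, and so the sorting key, is arbitrary; the Fourier
  -- coefficients vanish there.
  let inv : ℕ → ι := Function.invFunOn κ U
  have hinv : ∀ p ∈ U, inv (κ p) = p := fun p hp => hκ.leftInvOn_invFunOn hp
  obtain ⟨σ, hσ⟩ := exists_perm_monotone N fun j => r (inv j)
  refine ⟨σ, ?_⟩
  let a : ℤ → ℂ := fun j => (Real.sqrt D : ℂ)⁻¹ * c (inv j.toNat)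
  let U' : Finset ℤ := U.image fun p => (κ p : ℤ)
  have hinj : Set.InjOn (fun p => (κ p : ℤ)) U := fun p hp q hq h => hκ hp hq (by simpa using h)
  let f : TorusL2 := trigPolyL2 U' a
  have hsD : 0 < Real.sqrt D := Real.sqrt_pos.2 hD
  have hf : ‖f‖ ≤ 1 := by
    rw [← abs_of_nonneg (norm_nonneg f), ← sq_le_one_iff_abs_le_one, norm_trigPolyL2_sq,
      Finset.sum_image hinj]
    have : ∀ p ∈ U, ‖a (κ p : ℤ)‖ ^ 2 = D⁻¹ * ‖c p‖ ^ 2 := by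
      intro p hp
      simp only [a, Int.toNat_natCast, hinv p hp]
      rw [norm_mul, mul_pow, norm_inv, inv_pow, Complex.norm_real, Real.norm_of_nonneg hsD.le,
        Real.sq_sqrt hD.le]
    rw [Finset.sum_congr rfl this, ← Finset.mul_sum, inv_mul_le_iff₀ hD]
    simpa using hcD
  have hpart : ∀ (x : UnitAddCircle) t, ∑ j ∈ Finset.Icc 1 N with r (inv j) < t,
      fourierCoeff (f : UnitAddCircle → ℂ) (j : ℤ) * fourier (j : ℤ) x =
      (Real.sqrt D : ℂ)⁻¹ * ∑ p ∈ U with r p < t, c p * fourier (κ p : ℤ) x := by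
    intro x t
    have himg : (U.filter fun p => r p < t).image κ ⊆
        (Finset.Icc 1 N).filter fun j => r (inv j) < t := by
      intro j hj
      obtain ⟨p, hp, rfl⟩ := Finset.mem_image.1 hj
      rw [Finset.mem_filter] at hp ⊢
      exact ⟨hN p hp.1, by rw [hinv p hp.1]; exact hp.2⟩
    rw [← Finset.sum_subset himg, Finset.sum_image (hκ.mono (Finset.filter_subset _ _)), Finset.mul_sum]
    · refine Finset.sum_congr rfl fun p hp => ?_
      have hpU := (Finset.mem_filter.1 hp).1
      rw [fourierCoeff_trigPolyL2, if_pos (Finset.mem_image_of_mem _ hpU)]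
      simp only [a, Int.toNat_natCast, hinv p hpU]
      ring
    · intro j hj hj'
      rw [fourierCoeff_trigPolyL2, if_neg, zero_mul]
      intro hjU
      obtain ⟨p, hp, hpj⟩ := Finset.mem_image.1 hjU
      obtain rfl : κ p = j := by exact_mod_cast hpj
      refine hj' (Finset.mem_image_of_mem _ (Finset.mem_filter.2 ⟨hp, ?_⟩))
      simpa [hinv p hp] using (Finset.mem_filter.1 hj).2
  have hlamD : 0 < lam / Real.sqrt D := div_pos hlam hsD
  have hsub : X ⊆ {x | lam / Real.sqrt D < |rearrangedMaximal σ f x|} := by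
    intro x hx
    obtain ⟨t, ht⟩ := hXt x hx
    have h := norm_sum_key_lt_le (key := fun j => r (inv j)) hσ f x t
    rw [hpart, norm_mul, norm_inv, Complex.norm_real, Real.norm_of_nonneg hsD.le] at h
    rw [Set.mem_ofPred_eq, abs_of_nonneg (rearrangedMaximal_nonneg _ _ _)]
    refine lt_of_lt_of_le ?_ h
    rw [div_eq_inv_mul]
    exact mul_lt_mul_of_pos_left ht (inv_pos.2 hsD)
  calc ENNReal.ofReal (lam / Real.sqrt D * Real.sqrt δ)
      = ENNReal.ofReal (lam / Real.sqrt D) * (ENNReal.ofReal δ) ^ (1 / 2 : ℝ) := by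
        rw [ENNReal.ofReal_mul hlamD.le, Real.sqrt_eq_rpow δ,
          ENNReal.ofReal_rpow_of_nonneg hδ (by norm_num)]
    _ ≤ ENNReal.ofReal (lam / Real.sqrt D) * (AddCircle.haarAddCircle (T := (1 : ℝ))
          {x | lam / Real.sqrt D < |rearrangedMaximal σ f x|}) ^ (1 / 2 : ℝ) := by
        gcongr
        exact hX.trans (MeasureTheory.measure_mono hsub)
    _ ≤ weakL2Norm (rearrangedMaximal σ) := by
        unfold weakL2Norm
        exact le_iSup₂_of_le f hf (le_iSup₂_of_le (lam / Real.sqrt D) hlamD le_rfl)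

/-! ### Sparse approximation of product functions. -/

/-- The torus `(ℝ / ℤ) ^ V` with the product Haar measure. -/
noncomputable abbrev torusMeasure (V : Type*) [Fintype V] : Measure (UnitAddTorus V) :=
  Measure.pi fun _ : V => AddCircle.haarAddCircle

theorem mFourierCoeff_prod {V : Type*} [Fintype V] (g : V → UnitAddCircle → ℂ) (L : V → ℤ) :
    UnitAddTorus.mFourierCoeff (fun θ : UnitAddTorus V => ∏ v, g v (θ v)) L =
      ∏ v, fourierCoeff (g v) (L v) := by
  unfold UnitAddTorus.mFourierCoeff fourierCoeff
  have h := integral_fintype_prod_eq_prod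
    (μ := fun _ : V => AddCircle.haarAddCircle (T := (1 : ℝ)))
    (fun v (t : UnitAddCircle) => fourier (-(L v)) t • g v t)
  rw [← h]
  congr 1
  funext θ
  simp [UnitAddTorus.mFourier, Finset.prod_mul_distrib]

/-- A finite set of vectors lies in a box, over which the sum of products factorises. This makes the
ℓ^{3/2} bounds of the factors multiply. -/
theorem sum_prod_le_prod {V : Type*} [Fintype V] (b : V → ℤ → ℝ) (hb : ∀ v r, 0 ≤ b v r)
    (C : V → ℝ) (hC : ∀ v (S : Finset ℤ), ∑ r ∈ S, b v r ≤ C v) (G : Finset (V → ℤ)) :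
    ∑ L ∈ G, ∏ v, b v (L v) ≤ ∏ v, C v := by
  classical
  have hsub : G ⊆ Fintype.piFinset fun v => G.image fun L => L v := fun L hL =>
    Fintype.mem_piFinset.2 fun v => Finset.mem_image_of_mem _ hL
  calc _ ≤ ∑ L ∈ Fintype.piFinset fun v => G.image fun L => L v, ∏ v, b v (L v) :=
        Finset.sum_le_sum_of_subset_of_nonneg hsub fun L _ _ =>
          Finset.prod_nonneg fun v _ => hb v _
    _ = ∏ v, ∑ r ∈ G.image fun L => L v, b v r := (Finset.prod_univ_sum _ _).symm
    _ ≤ _ := Finset.prod_le_prod (fun v _ => Finset.sum_nonneg fun r _ => hb v r)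
        fun v _ => hC v _

/-- A product function with unit bound, whose factors have Fourier coefficients in `ℓ ^ (3 / 2)`, is
well approximated in `L²` by its large Fourier coefficients. -/
theorem exists_sparse_approx {V : Type*} [Fintype V] (g : V → UnitAddCircle → ℂ)
    (hgm : ∀ v, Measurable (g v)) (hg1 : ∀ v t, ‖g v t‖ ≤ 1) (C : V → ℝ)
    (hC : ∀ v (S : Finset ℤ), ∑ r ∈ S, ‖fourierCoeff (g v) r‖ ^ (3 / 2 : ℝ) ≤ C v)
    {ε : ℝ} (hε : 0 < ε) :
    ∃ H : Finset (V → ℤ),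
      (∀ L ∈ H, ε ^ 2 ≤ ∏ v, ‖fourierCoeff (g v) (L v)‖) ∧
      ∑ L ∈ H, ‖∏ v, fourierCoeff (g v) (L v)‖ ^ 2 ≤ ∫ θ, ‖∏ v, g v (θ v)‖ ^ 2 ∂torusMeasure V ∧
      ∫ θ, ‖∏ v, g v (θ v) -
        ∑ L ∈ H, (∏ v, fourierCoeff (g v) (L v)) * UnitAddTorus.mFourier L θ‖ ^ 2 ∂torusMeasure V
        ≤ ε * ∏ v, C v := by
  classical
  set F : UnitAddTorus V → ℂ := fun θ => ∏ v, g v (θ v) with hF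
  have hFm : Measurable F := by
    refine Finset.measurable_prod _ fun v _ => (hgm v).comp (measurable_pi_apply v)
  have hFL : MemLp F 2 (torusMeasure V) := by
    refine MemLp.of_bound hFm.aestronglyMeasurable 1 (ae_of_all _ fun θ => ?_)
    rw [hF, norm_prod]
    exact Finset.prod_le_one (fun _ _ => norm_nonneg _) fun v _ => hg1 v _
  set a : (V → ℤ) → ℂ := fun L => ∏ v, fourierCoeff (g v) (L v) with ha
  set f : Lp ℂ 2 (torusMeasure V) := hFL.toLp F with hf
  have hfF : (f : UnitAddTorus V → ℂ) =ᵐ[torusMeasure V] F := hFL.coeFn_toLp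
  have hcoef : ∀ L, UnitAddTorus.mFourierCoeff (f : UnitAddTorus V → ℂ) L = a L := by
    intro L
    refine Eq.trans ?_ (mFourierCoeff_prod g L)
    refine integral_congr_ae ?_
    filter_upwards [hfF] with θ hθ
    rw [hθ]
  have hs : HasSum (fun L => ‖a L‖ ^ 2) (∫ θ, ‖F θ‖ ^ 2 ∂torusMeasure V) := by
    have h := UnitAddTorus.hasSum_sq_mFourierCoeff f
    simp only [hcoef] at h
    convert h using 1
    refine integral_congr_ae ?_
    filter_upwards [hfF] with θ hθ
    rw [hθ]
  have hfin : {L | ¬ ‖a L‖ ^ 2 < (ε ^ 2) ^ 2}.Finite :=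
    hs.summable.tendsto_cofinite_zero.eventually (gt_mem_nhds (by positivity))
  set H := hfin.toFinset with hH
  have hmem : ∀ L, L ∈ H ↔ ε ^ 2 ≤ ‖a L‖ := by
    intro L
    rw [hH, Set.Finite.mem_toFinset, Set.mem_ofPred_eq, not_lt,
      pow_le_pow_iff_left₀ (by positivity) (norm_nonneg _) two_ne_zero]
  refine ⟨H, fun L hL => ?_, sum_le_hasSum _ (fun _ _ => by positivity) hs, ?_⟩
  · have := (hmem L).1 hL
    rwa [ha, norm_prod] at this
  set p : Lp ℂ 2 (torusMeasure V) := ∑ L ∈ H, a L • UnitAddTorus.mFourierLp 2 L with hp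
  have hpP : (p : UnitAddTorus V → ℂ) =ᵐ[torusMeasure V]
      fun θ => ∑ L ∈ H, a L * UnitAddTorus.mFourier L θ := by
    have h1 : ∀ L ∈ H, ((a L • UnitAddTorus.mFourierLp 2 L : Lp ℂ 2 (torusMeasure V)) :
        UnitAddTorus V → ℂ) =ᵐ[torusMeasure V] fun θ => a L * UnitAddTorus.mFourier L θ := by
      intro L _
      filter_upwards [Lp.coeFn_smul (a L) (UnitAddTorus.mFourierLp 2 L :
        Lp ℂ 2 (torusMeasure V)), UnitAddTorus.coeFn_mFourierLp 2 L] with θ h1 h2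
      rw [h1, Pi.smul_apply, h2, smul_eq_mul]
    refine (Lp.coeFn_finsetSum H _).trans ?_
    have h2 := (Finset.eventually_all H).2 h1
    filter_upwards [h2] with θ hθ
    rw [Finset.sum_apply]
    exact Finset.sum_congr rfl hθ
  have hrepr : ∀ L, UnitAddTorus.mFourierCoeff ((f - p : Lp ℂ 2 (torusMeasure V)) :
      UnitAddTorus V → ℂ) L = if L ∈ H then 0 else a L := by
    intro L
    have h0 : inner ℂ (UnitAddTorus.mFourierLp 2 L) f = a L := by
      rw [← hcoef, ← UnitAddTorus.mFourierBasis_repr, HilbertBasis.repr_apply_apply,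
        UnitAddTorus.coe_mFourierBasis]
    have h1 : inner ℂ (UnitAddTorus.mFourierLp 2 L) p = if L ∈ H then a L else 0 := by
      split_ifs with h
      · exact UnitAddTorus.orthonormal_mFourier.inner_right_sum a h
      · rw [hp, inner_sum]
        refine Finset.sum_eq_zero fun k hk => ?_
        rw [inner_smul_right, UnitAddTorus.orthonormal_mFourier.inner_eq_zero
          (by rintro rfl; exact h hk), mul_zero]
    refine (UnitAddTorus.mFourierBasis_repr (f - p) L).symm.trans ?_
    rw [HilbertBasis.repr_apply_apply, UnitAddTorus.coe_mFourierBasis]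
    refine (inner_sub_right _ _ _).trans ?_
    rw [h0, h1]
    split_ifs <;> simp
  have hs2 := UnitAddTorus.hasSum_sq_mFourierCoeff (f - p)
  have hint : ∫ θ, ‖F θ - ∑ L ∈ H, a L * UnitAddTorus.mFourier L θ‖ ^ 2 ∂torusMeasure V =
      ∫ θ, ‖(f - p : Lp ℂ 2 (torusMeasure V)) θ‖ ^ 2 ∂torusMeasure V := by
    refine integral_congr_ae ?_
    filter_upwards [hfF, hpP, Lp.coeFn_sub f p] with θ h1 h2 h3
    rw [h3, Pi.sub_apply, h1, h2]
  rw [hint]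
  refine hasSum_le_of_sum_le hs2 fun G => ?_
  calc _ ≤ ∑ L ∈ G, ε * ∏ v, ‖fourierCoeff (g v) (L v)‖ ^ (3 / 2 : ℝ) := by
        refine Finset.sum_le_sum fun L _ => ?_
        rw [hrepr]
        split_ifs with h
        · simp only [norm_zero, ne_eq, OfNat.ofNat_ne_zero, not_false_eq_true, zero_pow]
          positivity
        · rw [hmem, not_le] at h
          -- Outside `H` the factor |a_L|^{1/2} is at most ε, and the remaining |a_L|^{3/2} is
          -- summable with product bounds.
          have e1 : ‖a L‖ ^ (2 : ℕ) = ‖a L‖ ^ (1 / 2 : ℝ) * ‖a L‖ ^ (3 / 2 : ℝ) := by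
            rw [← Real.rpow_add_of_nonneg (norm_nonneg _) (by norm_num) (by norm_num),
              ← Real.rpow_natCast]
            norm_num
          have e2 : ‖a L‖ ^ (3 / 2 : ℝ) = ∏ v, ‖fourierCoeff (g v) (L v)‖ ^ (3 / 2 : ℝ) := by
            rw [ha, norm_prod, Real.finsetProd_rpow _ _ fun _ _ => norm_nonneg _]
          rw [e1, ← e2]
          refine mul_le_mul_of_nonneg_right ?_ (by positivity)
          rw [← Real.sqrt_eq_rpow, Real.sqrt_le_left hε.le]
          exact h.le
    _ ≤ _ := by
        rw [← Finset.mul_sum]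
        exact mul_le_mul_of_nonneg_left (sum_prod_le_prod
          (fun v r => ‖fourierCoeff (g v) r‖ ^ (3 / 2 : ℝ)) (fun _ _ => by positivity) C hC G) hε.le

/-! ### Half circles and their Fourier coefficients. -/

/-- Whether a point of the circle lies in the upper half `(0, 1 / 2]`. -/
noncomputable def isUpper (θ : UnitAddCircle) : Bool :=
  decide ((AddCircle.measurableEquivIoc 1 0 θ : ℝ) ≤ 1 / 2)

/-- The indicator functions of the upper and of the lower half of the circle. -/
noncomputable def halfIndicator (b : Bool) (θ : UnitAddCircle) : ℂ :=
  if isUpper θ = b then 1 else 0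

theorem measurable_isUpper : Measurable isUpper := by
  unfold isUpper
  refine measurable_to_bool ?_
  have : (fun θ : UnitAddCircle => decide ((AddCircle.measurableEquivIoc 1 0 θ : ℝ) ≤ 1 / 2)) ⁻¹'
      {true} = {θ | (AddCircle.measurableEquivIoc 1 0 θ : ℝ) ≤ 1 / 2} := by
    ext; simp
  rw [this]
  exact measurableSet_le (measurable_subtype_coe.comp
    (AddCircle.measurableEquivIoc 1 0).measurable) measurable_const

theorem measurable_halfIndicator (b : Bool) : Measurable (halfIndicator b) := by
  unfold halfIndicator
  exact Measurable.ite (measurable_isUpper (MeasurableSet.singleton b)) measurable_const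
    measurable_const

theorem isUpper_coe {x : ℝ} (hx : x ∈ Set.Ioc (0 : ℝ) 1) :
    isUpper (x : UnitAddCircle) = decide (x ≤ 1 / 2) := by
  have hx' : x ∈ Set.Ioc (0 : ℝ) (0 + 1) := by simpa using hx
  have : ((AddCircle.measurableEquivIoc 1 0 (x : UnitAddCircle)) : ℝ) = x := by
    change ((AddCircle.equivIoc 1 0 (x : UnitAddCircle) : _) : ℝ) = x
    rw [AddCircle.equivIoc_coe_of_mem hx']
  rw [isUpper, this]

theorem fourierCoeff_halfIndicator_true (n : ℤ) : fourierCoeff (halfIndicator true) n =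
    ∫ x in (0 : ℝ)..(1 / 2), Complex.exp (-(2 * Real.pi * Complex.I * n) * x) := by
  rw [fourierCoeff_eq_intervalIntegral _ _ 0, zero_add, div_one, one_smul,
    intervalIntegral.integral_of_le zero_le_one, intervalIntegral.integral_of_le (by norm_num)]
  have : Set.Ioc (0 : ℝ) (1 / 2) = Set.Ioc 0 1 ∩ Set.Iic (1 / 2) := by
    rw [Set.Ioc_inter_Iic]; norm_num
  rw [this, ← setIntegral_indicator measurableSet_Iic]
  refine setIntegral_congr_fun measurableSet_Ioc fun x hx => ?_
  simp only [Set.indicator, Set.mem_Iic, halfIndicator, isUpper_coe hx, decide_eq_true_eq]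
  split_ifs
  · rw [fourier_coe_apply, smul_eq_mul, mul_one]
    congr 1; push_cast; ring
  · simp

theorem fourierCoeff_halfIndicator_false (n : ℤ) : fourierCoeff (halfIndicator false) n =
    ∫ x in (1 / 2 : ℝ)..1, Complex.exp (-(2 * Real.pi * Complex.I * n) * x) := by
  rw [fourierCoeff_eq_intervalIntegral _ _ 0, zero_add, div_one, one_smul,
    intervalIntegral.integral_of_le zero_le_one, intervalIntegral.integral_of_le (by norm_num)]
  have : Set.Ioc (1 / 2 : ℝ) 1 = Set.Ioc 0 1 ∩ Set.Ioi (1 / 2) := by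
    rw [Set.Ioc_inter_Ioi]; norm_num
  rw [this, ← setIntegral_indicator measurableSet_Ioi]
  refine setIntegral_congr_fun measurableSet_Ioc fun x hx => ?_
  simp only [Set.indicator, Set.mem_Ioi, halfIndicator, isUpper_coe hx, decide_eq_false_iff_not,
    not_le]
  split_ifs
  · rw [fourier_coe_apply, smul_eq_mul, mul_one]
    congr 1; push_cast; ring
  · simp

theorem fourierCoeff_halfIndicator_zero (b : Bool) : fourierCoeff (halfIndicator b) 0 = 1 / 2 := by
  cases b
  · rw [fourierCoeff_halfIndicator_false]; simp; norm_num
  · rw [fourierCoeff_halfIndicator_true]; simp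

theorem integral_halfIndicator (b : Bool) :
    ∫ θ, halfIndicator b θ ∂AddCircle.haarAddCircle = 1 / 2 := by
  rw [← fourierCoeff_halfIndicator_zero b, fourierCoeff]
  simp

theorem norm_fourierCoeff_halfIndicator_le (b : Bool) {n : ℤ} (hn : n ≠ 0) :
    ‖fourierCoeff (halfIndicator b) n‖ ≤ |(n : ℝ)|⁻¹ := by
  have hc : -(2 * Real.pi * Complex.I * n) ≠ 0 := by
    simp [hn, Real.pi_ne_zero, Complex.I_ne_zero]
  have key : ∀ x y : ℝ, ‖∫ t in x..y, Complex.exp (-(2 * Real.pi * Complex.I * n) * t)‖ ≤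
      |(n : ℝ)|⁻¹ := by
    intro x y
    have he : ∀ t : ℝ, ‖Complex.exp (-(2 * Real.pi * Complex.I * n) * t)‖ = 1 := by
      intro t
      have : -(2 * Real.pi * Complex.I * n) * t = ((-(2 * Real.pi * n * t) : ℝ) : ℂ) * Complex.I := by
        push_cast; ring
      rw [this, Complex.norm_exp_ofReal_mul_I]
    have hn' : 0 < |(n : ℝ)| := abs_pos.2 (by exact_mod_cast hn)
    rw [integral_exp_mul_complex hc, norm_div, norm_neg]
    have h1 : ‖(2 * Real.pi * Complex.I * n : ℂ)‖ = 2 * Real.pi * |(n : ℝ)| := by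
      simp [abs_of_pos Real.pi_pos]
    rw [h1, div_le_iff₀ (by positivity)]
    refine (norm_sub_le _ _).trans ?_
    rw [he, he]
    have := Real.pi_gt_three
    field_simp
    linarith
  cases b
  · rw [fourierCoeff_halfIndicator_false]; exact key _ _
  · rw [fourierCoeff_halfIndicator_true]; exact key _ _

/-- This is the source of the gain: on the upper half the character has nonnegative imaginary part,
with integral 1/π. -/
theorem integral_halfIndicator_mul_fourier :
    ∫ θ, halfIndicator true θ * fourier 1 θ ∂AddCircle.haarAddCircle =
      Complex.I / Real.pi := by
  have h : ∫ θ, halfIndicator true θ * fourier 1 θ ∂AddCircle.haarAddCircle =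
      fourierCoeff (halfIndicator true) (-1) := by
    rw [fourierCoeff]
    simp [mul_comm]
  have hc : -(2 * Real.pi * Complex.I * ((-1 : ℤ) : ℂ)) ≠ 0 := by
    simp [Real.pi_ne_zero, Complex.I_ne_zero]
  have hpi : (Real.pi : ℂ) ≠ 0 := by exact_mod_cast Real.pi_ne_zero
  rw [h, fourierCoeff_halfIndicator_true, integral_exp_mul_complex hc]
  have e1 : -(2 * Real.pi * Complex.I * ((-1 : ℤ) : ℂ)) * ((1 / 2 : ℝ) : ℂ) =
      Real.pi * Complex.I := by push_cast; ring
  rw [e1, Complex.exp_pi_mul_I]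
  push_cast
  rw [mul_zero, Complex.exp_zero]
  field_simp
  rw [Complex.I_sq]; norm_num

theorem norm_fourierCoeff_le_one {g : UnitAddCircle → ℂ} (hg : ∀ t, ‖g t‖ ≤ 1) (n : ℤ) :
    ‖fourierCoeff g n‖ ≤ 1 := by
  refine (norm_integral_le_of_norm_le_const (C := 1) (ae_of_all _ fun t => ?_)).trans (by simp)
  rw [norm_smul, fourier_apply, Circle.norm_coe, one_mul]
  exact hg t

theorem norm_halfIndicator_le (b : Bool) (θ : UnitAddCircle) : ‖halfIndicator b θ‖ ≤ 1 := by
  unfold halfIndicator; split_ifs <;> simp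

/-- The decay 1/|r| puts the coefficients in ℓ^p for every p > 1. An exponent below 2 is what the
sparse approximation needs. -/
theorem exists_sum_fourierCoeff_halfIndicator_le : ∃ C : ℕ, 1 ≤ C ∧ ∀ b (S : Finset ℤ),
    ∑ r ∈ S, ‖fourierCoeff (halfIndicator b) r‖ ^ (3 / 2 : ℝ) ≤ C := by
  have hs : Summable fun n : ℤ => |(n : ℝ)| ^ (-(3 / 2) : ℝ) :=
    Real.summable_abs_int_rpow (by norm_num)
  refine ⟨⌈1 + ∑' n : ℤ, |(n : ℝ)| ^ (-(3 / 2) : ℝ)⌉₊, ?_, fun b S => ?_⟩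
  · refine Nat.one_le_ceil_iff.2 ?_
    have : 0 ≤ ∑' n : ℤ, |(n : ℝ)| ^ (-(3 / 2) : ℝ) := tsum_nonneg fun _ => by positivity
    linarith
  · refine le_trans ?_ (Nat.le_ceil _)
    calc _ ≤ ∑ r ∈ S, ((if r = 0 then 1 else 0) + |(r : ℝ)| ^ (-(3 / 2) : ℝ)) := by
          refine Finset.sum_le_sum fun r _ => ?_
          split_ifs with h
          · refine (Real.rpow_le_one (norm_nonneg _)
              (norm_fourierCoeff_le_one (norm_halfIndicator_le b) r) (by norm_num)).trans ?_
            have : 0 ≤ |(r : ℝ)| ^ (-(3 / 2) : ℝ) := by positivity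
            linarith
          · rw [zero_add, Real.rpow_neg (abs_nonneg _), ← Real.inv_rpow (abs_nonneg _)]
            exact Real.rpow_le_rpow (norm_nonneg _) (norm_fourierCoeff_halfIndicator_le b h)
              (by norm_num)
      _ ≤ _ := by
          rw [Finset.sum_add_distrib]
          refine add_le_add ?_ (hs.sum_le_tsum S fun _ _ => by positivity)
          rw [Finset.sum_ite_eq']
          split_ifs <;> norm_num

/-! ### Passage from the torus to a closed geodesic. -/

theorem mFourier_add_smul {V : Type*} [Fintype V] (L m : V → ℤ) (φ : UnitAddTorus V)
    (x : UnitAddCircle) :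
    UnitAddTorus.mFourier L (fun v => φ v + m v • x) =
      UnitAddTorus.mFourier L φ * fourier (∑ v, L v * m v) x := by
  have hsum : ∀ S : Finset V, (fourier (∑ v ∈ S, L v * m v) x : ℂ) =
      ∏ v ∈ S, fourier (L v) (m v • x) := by
    classical
    intro S
    induction S using Finset.induction_on with
    | empty => simp
    | insert v S hv ih =>
      rw [Finset.sum_insert hv, Finset.prod_insert hv, fourier_add, ih]
      congr 1
      rw [fourier_apply, fourier_apply, mul_smul]
  rw [hsum]
  simp only [UnitAddTorus.mFourier, ContinuousMap.coe_mk, ← Finset.prod_mul_distrib]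
  refine Finset.prod_congr rfl fun v _ => ?_
  simp only [fourier_apply, smul_add, AddCircle.toCircle_add, Circle.coe_mul]

/-- Averaging over the phases, a function on the torus is at least as large in mean along some
translate of a given closed geodesic. -/
theorem exists_phase {V : Type*} [Fintype V] {W : UnitAddTorus V → ℝ} (hW : Measurable W) {B : ℝ}
    (hB : ∀ θ, ‖W θ‖ ≤ B) (m : V → ℤ) : ∃ φ : UnitAddTorus V, ∫ θ, W θ ∂torusMeasure V ≤
      ∫ x : UnitAddCircle, W (fun v => φ v + m v • x) ∂AddCircle.haarAddCircle := by
  have hmeas : Measurable fun p : UnitAddTorus V × UnitAddCircle =>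
      W (fun v => p.1 v + m v • p.2) := by
    refine hW.comp (measurable_pi_lambda _ fun v => ?_)
    exact ((measurable_pi_apply v).comp measurable_fst).add 
      ((continuous_zsmul (m v)).measurable.comp measurable_snd)
  have hint : Integrable (fun p : UnitAddTorus V × UnitAddCircle =>
      W (fun v => p.1 v + m v • p.2)) ((torusMeasure V).prod AddCircle.haarAddCircle) :=
    Integrable.of_bound hmeas.aestronglyMeasurable B (ae_of_all _ fun p => hB _)
  have hinner : ∀ x : UnitAddCircle, ∫ φ, W (fun v => φ v + m v • x) ∂torusMeasure V =
      ∫ θ, W θ ∂torusMeasure V := fun x =>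
    integral_add_right_eq_self (μ := torusMeasure V) W (fun v => m v • x)
  have hswap := integral_integral_swap
    (f := fun (φ : UnitAddTorus V) (x : UnitAddCircle) => W (fun v => φ v + m v • x)) hint
  obtain ⟨φ, hφ⟩ := exists_integral_le hint.integral_prod_left
  refine ⟨φ, le_trans (le_of_eq ?_) hφ⟩
  rw [hswap]
  simp [hinner]

/-- A reverse Chebyshev bound: W ≤ b/10 off the set S and W ≤ b on it, so b/5 ≤ ∫ W ≤ b/10 + b|S|.
-/
theorem le_measure_lt_of_le_integral {W : UnitAddCircle → ℝ} (hW : Measurable W)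
    (hint : Integrable W (AddCircle.haarAddCircle (T := (1 : ℝ)))) {b : ℝ} (hb : 0 < b)
    (hWb : ∀ x, W x ≤ b)
    (h : b / 5 ≤ ∫ x, W x ∂AddCircle.haarAddCircle) :
    ENNReal.ofReal (1 / 10) ≤ AddCircle.haarAddCircle (T := (1 : ℝ)) {x | b / 10 < W x} := by
  set S : Set UnitAddCircle := {x | b / 10 < W x} with hS
  have hSm : MeasurableSet S := measurableSet_lt measurable_const hW
  have h1 : ∫ x, W x ∂AddCircle.haarAddCircle ≤
      ∫ x, (b / 10 + S.indicator (fun _ => b) x) ∂AddCircle.haarAddCircle (T := (1 : ℝ)) := by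
    refine integral_mono hint
      ((integrable_const _).add ((integrable_const b).indicator hSm)) fun x => ?_
    by_cases hx : x ∈ S
    · simp only [hx, Set.indicator_of_mem]
      linarith [hWb x]
    · simp only [hx, not_false_eq_true, Set.indicator_of_notMem, add_zero]
      simpa [hS] using hx
  rw [integral_add (integrable_const _) ((integrable_const b).indicator hSm),
    integral_indicator_const _ hSm] at h1
  simp only [integral_const, probReal_univ, smul_eq_mul] at h1
  rw [ENNReal.ofReal_le_iff_le_toReal (measure_ne_top _ _)]
  change 1 / 10 ≤ Measure.real _ S
  by_contra! hlt
  have := mul_lt_mul_of_pos_right hlt hb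
  linarith

/-! ### The functions attached to the nodes. -/

namespace InorderTree

variable {V : Type} {n : ℕ} (T : InorderTree V n)

open Classical in
/-- The factors of the function attached to the node `v`: the character at `v`, and indicators of
half circles at the ancestors of `v`. -/
noncomputable def factor (v a : V) (θ : UnitAddCircle) : ℂ :=
  if a = v then fourier 1 θ else if a ∈ T.anc v then halfIndicator (T.side v a) θ else 1

theorem factor_self (v : V) : T.factor v v = fun θ => (fourier 1 θ : ℂ) := by
  funext; simp [factor]

theorem factor_of_mem {v a : V} (h : a ∈ T.anc v) :
    T.factor v a = halfIndicator (T.side v a) := by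
  have : a ≠ v := by rintro rfl; exact T.not_mem_anc_self _ h
  funext; simp [factor, h, this]

theorem factor_of_notMem {v a : V} (h : a ≠ v) (h' : a ∉ T.anc v) :
    T.factor v a = fun _ => 1 := by
  funext; simp [factor, h, h']

theorem measurable_factor (v a : V) : Measurable (T.factor v a) := by
  by_cases h : a = v
  · subst h; rw [factor_self]; exact (fourier 1).continuous.measurable
  by_cases h' : a ∈ T.anc v
  · rw [T.factor_of_mem h']; exact measurable_halfIndicator _
  · rw [T.factor_of_notMem h h']; exact measurable_const

theorem norm_factor_le (v a : V) (θ : UnitAddCircle) : ‖T.factor v a θ‖ ≤ 1 := by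
  unfold factor
  split_ifs
  · rw [fourier_apply, Circle.norm_coe]
  · exact norm_halfIndicator_le _ _
  · simp

theorem fourierCoeff_factor_self (v : V) : fourierCoeff (T.factor v v) = Pi.single 1 1 := by
  rw [factor_self]; exact fourierCoeff_fourier 1

theorem fourierCoeff_factor_of_notMem {v a : V} (h : a ≠ v) (h' : a ∉ T.anc v) :
    fourierCoeff (T.factor v a) = Pi.single 0 1 := by
  rw [T.factor_of_notMem h h']
  have : (fun _ : UnitAddCircle => (1 : ℂ)) = fourier 0 := funext fun _ => fourier_zero.symm
  rw [this, fourierCoeff_fourier]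

theorem norm_fourierCoeff_factor_le (v a : V) {r : ℤ} (hr : r ≠ 0) :
    ‖fourierCoeff (T.factor v a) r‖ ≤ |(r : ℝ)|⁻¹ := by
  by_cases h : a = v
  · subst h
    rw [fourierCoeff_factor_self]
    by_cases h1 : r = 1
    · simp [h1]
    · simp [h1]
  by_cases h' : a ∈ T.anc v
  · rw [T.factor_of_mem h']; exact norm_fourierCoeff_halfIndicator_le _ hr
  · rw [T.fourierCoeff_factor_of_notMem h h']
    simp [hr]

open Classical in
theorem sum_fourierCoeff_factor_le {C : ℕ} (hC : ∀ b (S : Finset ℤ),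
    ∑ r ∈ S, ‖fourierCoeff (halfIndicator b) r‖ ^ (3 / 2 : ℝ) ≤ C) (v a : V) (S : Finset ℤ) :
    ∑ r ∈ S, ‖fourierCoeff (T.factor v a) r‖ ^ (3 / 2 : ℝ) ≤ if a ∈ T.anc v then (C : ℝ) else 1 := by
  have hsingle : ∀ k : ℤ, ∑ r ∈ S, ‖(Pi.single k 1 : ℤ → ℂ) r‖ ^ (3 / 2 : ℝ) ≤ 1 := by
    intro k
    calc _ = ∑ r ∈ S, if r = k then (1 : ℝ) else 0 := by
          refine Finset.sum_congr rfl fun r _ => ?_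
          rw [Pi.single_apply]
          split_ifs
          · simp
          · simp
      _ ≤ 1 := by
          rw [Finset.sum_ite_eq']
          split_ifs <;> norm_num
  by_cases h' : a ∈ T.anc v
  · rw [T.factor_of_mem h', if_pos h']; exact hC _ _
  rw [if_neg h']
  by_cases h : a = v
  · subst h; rw [fourierCoeff_factor_self]; exact hsingle 1
  · rw [T.fourierCoeff_factor_of_notMem h h']; exact hsingle 0

variable [Fintype V]

open Classical in
theorem prod_ite_anc_le {C : ℝ} (hC : 1 ≤ C) (v : V) :
    ∏ a, (if a ∈ T.anc v then C else 1) ≤ C ^ n := by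
  rw [Finset.prod_ite_mem, Finset.univ_inter, Finset.prod_const]
  exact pow_le_pow_right₀ hC (T.card_anc_le v)

-- The ancestor factors multiply to the indicator that `v` lies on the branch chosen by θ.
open Classical in
theorem prod_factor (v : V) (θ : UnitAddTorus V) : ∏ a, T.factor v a (θ a) =
    if T.Active (fun a => isUpper (θ a)) v then (fourier 1 (θ v) : ℂ) else 0 := by
  split_ifs with h
  · rw [Finset.prod_eq_single v]
    · rw [factor_self]
    · intro a _ hav
      by_cases h' : a ∈ T.anc v
      · rw [T.factor_of_mem h', halfIndicator, if_pos (h a h')]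
      · rw [T.factor_of_notMem hav h']
    · simp
  · simp only [Active, not_forall] at h
    obtain ⟨a, ha, hne⟩ := h
    refine Finset.prod_eq_zero (Finset.mem_univ a) ?_
    rw [T.factor_of_mem ha, halfIndicator, if_neg hne]

/-- Integrals of products which agree with the function of a node away from this node. -/
theorem integral_mul_prod_factor [DecidableEq V] (v : V) (h : UnitAddCircle → ℂ) :
    ∫ θ, h (θ v) * ∏ a ∈ Finset.univ.erase v, T.factor v a (θ a) ∂torusMeasure V =
      (∫ t, h t ∂AddCircle.haarAddCircle) * (1 / 2) ^ (T.anc v).card := by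
  have hprod : ∀ θ : UnitAddTorus V, h (θ v) * ∏ a ∈ Finset.univ.erase v, T.factor v a (θ a) =
      ∏ a, (if a = v then h else T.factor v a) (θ a) := by
    intro θ
    rw [← Finset.mul_prod_erase _ _ (Finset.mem_univ v), if_pos rfl]
    congr 1
    refine Finset.prod_congr rfl fun a ha => ?_
    rw [if_neg (Finset.ne_of_mem_erase ha)]
  simp only [hprod]
  rw [integral_fintype_prod_eq_prod (fun a => if a = v then h else T.factor v a),
    ← Finset.mul_prod_erase _ _ (Finset.mem_univ v), if_pos rfl]
  congr 1
  have hterm : ∀ a ∈ Finset.univ.erase v, ∫ t, (if a = v then h else T.factor v a) t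
      ∂AddCircle.haarAddCircle = if a ∈ T.anc v then (1 / 2 : ℂ) else 1 := by
    intro a ha
    have hav := Finset.ne_of_mem_erase ha
    rw [if_neg hav]
    split_ifs with h'
    · rw [T.factor_of_mem h', integral_halfIndicator]
    · rw [T.factor_of_notMem hav h']; simp
  rw [Finset.prod_congr rfl hterm, Finset.prod_ite_mem, Finset.prod_const]
  congr 2
  refine Finset.inter_eq_right.2 fun a ha => Finset.mem_erase.2 ⟨?_, Finset.mem_univ _⟩
  rintro rfl
  exact T.not_mem_anc_self _ ha

/-- The function of `v` is unimodular on its support, so its squared modulus is a product of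
independent half-circle indicators. -/
theorem integral_norm_prod_factor_sq (v : V) :
    ∫ θ, ‖∏ a, T.factor v a (θ a)‖ ^ 2 ∂torusMeasure V = (1 / 2) ^ (T.anc v).card := by
  classical
  have h := T.integral_mul_prod_factor v (fun _ => 1)
  have hpt : ∀ θ : UnitAddTorus V, 1 * ∏ a ∈ Finset.univ.erase v, T.factor v a (θ a) =
      ((‖∏ a, T.factor v a (θ a)‖ ^ 2 : ℝ) : ℂ) := by
    intro θ
    have h1 := Finset.mul_prod_erase Finset.univ (fun a => T.factor v a (θ a)) (Finset.mem_univ v)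
    have h2 : ‖(fourier 1 (θ v) : ℂ)‖ = 1 := by rw [fourier_apply, Circle.norm_coe]
    have h3 : (fourier 1 (θ v) : ℂ) ≠ 0 := norm_ne_zero_iff.1 (by rw [h2]; exact one_ne_zero)
    rw [prod_factor, factor_self] at h1
    rw [prod_factor, one_mul]
    split_ifs at h1 ⊢
    · rw [h2]
      simpa using mul_left_cancel₀ h3 (h1.trans (mul_one _).symm)
    · simpa [h3] using h1
  simp only [hpt] at h
  rw [integral_complex_ofReal] at h
  simp only [integral_const, probReal_univ, one_smul, one_mul] at h
  exact Complex.ofReal_injective (h.trans (by push_cast; rfl))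

theorem integral_im_upper_prod_factor (v : V) :
    ∫ θ, (halfIndicator true (θ v) * ∏ a, T.factor v a (θ a)).im ∂torusMeasure V =
      (1 / 2) ^ (T.anc v).card / Real.pi := by
  classical
  have h := T.integral_mul_prod_factor v (fun t => halfIndicator true t * fourier 1 t)
  have hpt : ∀ θ : UnitAddTorus V, halfIndicator true (θ v) * fourier 1 (θ v) *
      ∏ a ∈ Finset.univ.erase v, T.factor v a (θ a) =
      halfIndicator true (θ v) * ∏ a, T.factor v a (θ a) := by
    intro θ
    rw [← Finset.mul_prod_erase _ _ (Finset.mem_univ v), factor_self, mul_assoc]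
  simp only [hpt] at h
  rw [integral_halfIndicator_mul_fourier] at h
  have hint : Integrable (fun θ : UnitAddTorus V =>
      halfIndicator true (θ v) * ∏ a, T.factor v a (θ a)) (torusMeasure V) := by
    refine Integrable.of_bound (C := 1) (Measurable.aestronglyMeasurable ?_)
      (ae_of_all _ fun θ => ?_)
    · exact ((measurable_halfIndicator true).comp (measurable_pi_apply v)).mul
        (Finset.measurable_prod _ fun a _ => (T.measurable_factor v a).comp (measurable_pi_apply a))
    · rw [norm_mul, norm_prod]
      exact mul_le_one₀ (norm_halfIndicator_le _ _) (Finset.prod_nonneg fun _ _ => norm_nonneg _)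
        (Finset.prod_le_one (fun _ _ => norm_nonneg _) fun a _ => T.norm_factor_le v a _)
  have h2 := integral_im (𝕜 := ℂ) hint
  simp only [RCLike.im_to_complex] at h2
  rw [h2, h]
  have : Complex.I / Real.pi * (1 / 2) ^ (T.anc v).card =
      (((1 / 2) ^ (T.anc v).card / Real.pi : ℝ) : ℂ) * Complex.I := by push_cast; ring
  rw [this, Complex.mul_I_im, Complex.ofReal_re]

/-- Frequency vectors of different nodes are different. -/
theorem eq_of_prod_fourierCoeff_ne_zero {v w : V} {L : V → ℤ}
    (hv : ∏ a, fourierCoeff (T.factor v a) (L a) ≠ 0)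
    (hw : ∏ a, fourierCoeff (T.factor w a) (L a) ≠ 0) : v = w := by
  rw [Finset.prod_ne_zero_iff] at hv hw
  have key : ∀ u, fourierCoeff (T.factor u u) (L u) ≠ 0 → L u ≠ 0 := by
    intro u hu h0
    rw [fourierCoeff_factor_self, h0] at hu
    simp at hu
  have key2 : ∀ u a, fourierCoeff (T.factor u a) (L a) ≠ 0 → L a ≠ 0 → a ≠ u → a ∈ T.anc u := by
    intro u a hu hL hau
    by_contra h'
    rw [T.fourierCoeff_factor_of_notMem hau h'] at hu
    simp [hL] at hu
  by_contra hne
  -- In the spectrum of `v` the entry at `v` is 1, and nonzero entries occur only at `v` and its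
  -- ancestors. A common frequency would make `v` and `w` ancestors of each other.
  exact T.anc_asymm w v
    (key2 w v (hw v (Finset.mem_univ _)) (key v (hv v (Finset.mem_univ _))) hne)
    (key2 v w (hv w (Finset.mem_univ _)) (key w (hw w (Finset.mem_univ _))) (Ne.symm hne))

/-- All other factors are at most 1, so the factor at `a` alone is at least η, and it decays like
1/|r|. -/
theorem abs_le_of_le_prod_fourierCoeff {v : V} {L : V → ℤ} {η : ℝ} (hη : 0 < η)
    (h : η ≤ ∏ a, ‖fourierCoeff (T.factor v a) (L a)‖) (a : V) : |(L a : ℝ)| ≤ η⁻¹ := by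
  classical
  by_cases h0 : L a = 0
  · simp [h0, hη.le]
  have hpos : 0 < |(L a : ℝ)| := abs_pos.2 (by exact_mod_cast h0)
  rw [le_inv_comm₀ hpos hη]
  refine h.trans (le_trans ?_ (T.norm_fourierCoeff_factor_le v a h0))
  rw [← Finset.mul_prod_erase _ _ (Finset.mem_univ a)]
  exact mul_le_of_le_one_right (norm_nonneg _) (Finset.prod_le_one (fun _ _ => norm_nonneg _)
    fun _ _ => norm_fourierCoeff_le_one (T.norm_factor_le v _) _)

end InorderTree

/-- A quadratic bound for the mean of a nonnegative function. -/
theorem integral_norm_le_of_integral_sq_le {α : Type*} [MeasurableSpace α] {μ : Measure α}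
    [IsProbabilityMeasure μ] {G : α → ℂ} (hG : AEStronglyMeasurable G μ) {B : ℝ}
    (hB : ∀ x, ‖G x‖ ≤ B) {η : ℝ} (hη : 0 < η) (h : ∫ x, ‖G x‖ ^ 2 ∂μ ≤ η ^ 2) :
    ∫ x, ‖G x‖ ∂μ ≤ η := by
  have hi : Integrable (fun x => ‖G x‖) μ := (Integrable.of_bound hG B (ae_of_all _ hB)).norm
  have hi2 : Integrable (fun x => ‖G x‖ ^ 2) μ := by
    refine Integrable.of_bound (hG.norm.pow 2) (B ^ 2) (ae_of_all _ fun x => ?_)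
    rw [Real.norm_of_nonneg (by positivity)]
    exact pow_le_pow_left₀ (norm_nonneg _) (hB x) 2
  calc ∫ x, ‖G x‖ ∂μ ≤ ∫ x, (η / 2 + (2 * η)⁻¹ * ‖G x‖ ^ 2) ∂μ := by
        refine integral_mono hi ((integrable_const _).add (hi2.const_mul _)) fun x => ?_
        -- Pointwise ‖G‖ ≤ η/2 + ‖G‖²/(2η).
        have := sq_nonneg (η - ‖G x‖)
        simp only
        field_simp
        nlinarith
    _ = η / 2 + (2 * η)⁻¹ * ∫ x, ‖G x‖ ^ 2 ∂μ := by
        rw [integral_add (integrable_const _) (hi2.const_mul _), integral_const_mul]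
        simp
    _ ≤ η / 2 + (2 * η)⁻¹ * η ^ 2 := by gcongr
    _ = η := by field_simp; ring

/-! ### Truncations and the minorant of their maximal in-order sum. -/

namespace InorderTree

variable {V : Type} {n : ℕ} (T : InorderTree V n) [Fintype V]

/-- The part of the Fourier series of the function of the node `v` with frequencies in `H`. -/
noncomputable def truncation (H : Finset (V → ℤ)) (v : V) (θ : UnitAddTorus V) : ℂ :=
  ∑ L ∈ H, (∏ a, fourierCoeff (T.factor v a) (L a)) * UnitAddTorus.mFourier L θ

/-- A lower bound for the maximal partial sum of the truncations over the nodes in order: the sum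
of the positive parts along the branch, minus the truncation errors. -/
noncomputable def minorant (H : V → Finset (V → ℤ)) (θ : UnitAddTorus V) : ℝ :=
  ∑ v, (halfIndicator true (θ v) * ∏ a, T.factor v a (θ a)).im -
    ∑ v, ‖∏ a, T.factor v a (θ a) - T.truncation (H v) v θ‖

theorem continuous_truncation (H : Finset (V → ℤ)) (v : V) : Continuous (T.truncation H v) :=
  continuous_finsetSum _ fun L _ => continuous_const.mul (UnitAddTorus.mFourier L).continuous

theorem measurable_prod_factor (v : V) :
    Measurable fun θ : UnitAddTorus V => ∏ a, T.factor v a (θ a) :=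
  Finset.measurable_prod _ fun a _ => (T.measurable_factor v a).comp (measurable_pi_apply a)

theorem norm_prod_factor_le (v : V) (θ : UnitAddTorus V) : ‖∏ a, T.factor v a (θ a)‖ ≤ 1 := by
  rw [norm_prod]
  exact Finset.prod_le_one (fun _ _ => norm_nonneg _) fun a _ => T.norm_factor_le v a _

theorem norm_truncation_le (H : Finset (V → ℤ)) (v : V) (θ : UnitAddTorus V) :
    ‖T.truncation H v θ‖ ≤ H.card := by
  refine (norm_sum_le _ _).trans ?_
  rw [← nsmul_one (H.card), ← Finset.sum_const]
  refine Finset.sum_le_sum fun L _ => ?_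
  rw [norm_mul, norm_prod]
  refine mul_le_one₀ (Finset.prod_le_one (fun _ _ => norm_nonneg _)
    fun a _ => norm_fourierCoeff_le_one (T.norm_factor_le v a) _) (norm_nonneg _) ?_
  exact ((UnitAddTorus.mFourier L).norm_coe_le_norm θ).trans UnitAddTorus.mFourier_norm.le

theorem measurable_upper_im (v : V) : Measurable fun θ : UnitAddTorus V =>
    (halfIndicator true (θ v) * ∏ a, T.factor v a (θ a)).im :=
  Complex.measurable_im.comp
    (((measurable_halfIndicator true).comp (measurable_pi_apply v)).mul (T.measurable_prod_factor v))

theorem measurable_error (H : Finset (V → ℤ)) (v : V) : Measurable fun θ : UnitAddTorus V =>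
    ∏ a, T.factor v a (θ a) - T.truncation H v θ :=
  (T.measurable_prod_factor v).sub (T.continuous_truncation H v).measurable

theorem measurable_minorant (H : V → Finset (V → ℤ)) : Measurable (T.minorant H) :=
  (Finset.measurable_sum _ fun v _ => T.measurable_upper_im v).sub
    (Finset.measurable_sum _ fun v _ => (T.measurable_error (H v) v).norm)

theorem abs_upper_im_le (v : V) (θ : UnitAddTorus V) :
    |(halfIndicator true (θ v) * ∏ a, T.factor v a (θ a)).im| ≤ 1 := by
  refine (Complex.abs_im_le_norm _).trans ?_
  rw [norm_mul]
  exact mul_le_one₀ (norm_halfIndicator_le _ _) (norm_nonneg _) (T.norm_prod_factor_le v θ)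

theorem norm_error_le (H : Finset (V → ℤ)) (v : V) (θ : UnitAddTorus V) :
    ‖∏ a, T.factor v a (θ a) - T.truncation H v θ‖ ≤ 1 + H.card :=
  (norm_sub_le _ _).trans (add_le_add (T.norm_prod_factor_le v θ) (T.norm_truncation_le H v θ))

theorem norm_minorant_le (H : V → Finset (V → ℤ)) (θ : UnitAddTorus V) :
    ‖T.minorant H θ‖ ≤ ∑ _v : V, (1 : ℝ) + ∑ v, (1 + ((H v).card : ℝ)) := by
  unfold minorant
  refine (norm_sub_le _ _).trans (add_le_add ?_ ?_)
  · exact (norm_sum_le _ _).trans (Finset.sum_le_sum fun v _ => T.abs_upper_im_le v θ)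
  · refine (norm_sum_le _ _).trans (Finset.sum_le_sum fun v _ => ?_)
    rw [norm_norm]
    exact T.norm_error_le _ _ _

open Classical in
theorem minorant_le (hT : ∀ b : V → Bool, (Finset.univ.filter (T.Active b)).card ≤ n)
    (H : V → Finset (V → ℤ)) (θ : UnitAddTorus V) : T.minorant H θ ≤ n := by
  have h2 : 0 ≤ ∑ v, ‖∏ a, T.factor v a (θ a) - T.truncation (H v) v θ‖ :=
    Finset.sum_nonneg fun _ _ => norm_nonneg _
  have h1 : ∑ v, (halfIndicator true (θ v) * ∏ a, T.factor v a (θ a)).im ≤ n := by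
    calc _ ≤ ∑ v, if T.Active (fun a => isUpper (θ a)) v then (1 : ℝ) else 0 := by
          refine Finset.sum_le_sum fun v _ => ?_
          have h := (le_abs_self _).trans (T.abs_upper_im_le v θ)
          rw [prod_factor] at h ⊢
          split_ifs at h ⊢
          · exact h
          · simp
      _ = ((Finset.univ.filter (T.Active fun a => isUpper (θ a))).card : ℝ) := by
          rw [Finset.sum_boole]
      _ ≤ n := by exact_mod_cast hT _
  unfold minorant
  linarith

theorem le_integral_minorant
    (hsum : ∑ v, (1 / 2 : ℝ) ^ (T.anc v).card = n) (H : V → Finset (V → ℤ)) {η : ℝ} (hη : 0 < η)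
    (hH : ∀ v, ∫ θ, ‖∏ a, T.factor v a (θ a) - T.truncation (H v) v θ‖ ^ 2 ∂torusMeasure V ≤ η ^ 2) :
    n / Real.pi - Fintype.card V * η ≤ ∫ θ, T.minorant H θ ∂torusMeasure V := by
  have hi1 : ∀ v ∈ Finset.univ, Integrable (fun θ : UnitAddTorus V =>
      (halfIndicator true (θ v) * ∏ a, T.factor v a (θ a)).im) (torusMeasure V) := fun v _ =>
    Integrable.of_bound (T.measurable_upper_im v).aestronglyMeasurable 1
      (ae_of_all _ fun θ => T.abs_upper_im_le v θ)
  have hi2 : ∀ v ∈ Finset.univ, Integrable (fun θ : UnitAddTorus V =>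
      ‖∏ a, T.factor v a (θ a) - T.truncation (H v) v θ‖) (torusMeasure V) := fun v _ =>
    (Integrable.of_bound (T.measurable_error (H v) v).aestronglyMeasurable _
      (ae_of_all _ fun θ => T.norm_error_le (H v) v θ)).norm
  unfold minorant
  rw [integral_sub (integrable_finsetSum _ hi1) (integrable_finsetSum _ hi2),
    integral_finsetSum _ hi1, integral_finsetSum _ hi2]
  simp only [integral_im_upper_prod_factor]
  rw [← Finset.sum_div, hsum]
  refine sub_le_sub_left ?_ _
  rw [← nsmul_eq_mul, ← Finset.card_univ, ← Finset.sum_const]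
  exact Finset.sum_le_sum fun v _ => integral_norm_le_of_integral_sq_le
    (T.measurable_error (H v) v).aestronglyMeasurable (T.norm_error_le (H v) v) hη (hH v)

/-- The in-order partial sum up to the end of the branch of `θ` is at least the minorant. -/
theorem exists_minorant_le_norm (H : V → Finset (V → ℤ)) (θ : UnitAddTorus V) :
    ∃ t, T.minorant H θ ≤ ‖∑ v with T.rank v < t, T.truncation (H v) v θ‖ := by
  classical
  obtain ⟨t, -, -, ht⟩ := T.branch fun a => isUpper (θ a)
  refine ⟨t, le_trans ?_ ((le_abs_self _).trans (Complex.abs_im_le_norm _))⟩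
  rw [Complex.im_sum, Finset.sum_filter, minorant, ← Finset.sum_sub_distrib]
  refine Finset.sum_le_sum fun v _ => ?_
  -- On the branch, "before the end" and "upper half" are the same condition; off the branch the
  -- product vanishes.
  have h1 : (halfIndicator true (θ v) * ∏ a, T.factor v a (θ a)).im =
      if T.rank v < t then (∏ a, T.factor v a (θ a)).im else 0 := by
    rw [prod_factor]
    by_cases hv : T.Active (fun a => isUpper (θ a)) v
    · have htv := ht v hv
      by_cases hu : isUpper (θ v) = true
      · simp [hv, halfIndicator, hu, htv.2 hu]
      · simp [hv, halfIndicator, hu, mt htv.1 hu]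
    · simp [hv]
  rw [h1]
  have h2 := (le_abs_self _).trans (Complex.abs_im_le_norm
    (∏ a, T.factor v a (θ a) - T.truncation (H v) v θ))
  rw [Complex.sub_im] at h2
  split_ifs
  · linarith
  · linarith [norm_nonneg (∏ a, T.factor v a (θ a) - T.truncation (H v) v θ)]

end InorderTree

/-! ### Choice of parameters and conclusion. -/

theorem exists_le_weakL2Norm_of_pow_le : ∃ B : ℕ, 2 ≤ B ∧ ∀ n : ℕ, 1 ≤ n → ∀ N, B ^ n ≤ N →
    ∃ σ : Equiv.Perm (Finset.Icc 1 N),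
      ENNReal.ofReal (n / 10 / Real.sqrt n * Real.sqrt (1 / 10)) ≤
        weakL2Norm (rearrangedMaximal σ) := by
  classical
  obtain ⟨C, hC1, hC⟩ := exists_sum_fourierCoeff_halfIndicator_le
  have hC1' : (1 : ℝ) ≤ C := by exact_mod_cast hC1
  -- With ε = (400C)^{-n} the squared error of each node is at most ε C^n = 20^{-2n}. The at most
  -- 2^n nodes then cost at most 10^{-n} in the mean. The coefficients kept are at least ε² in size,
  -- so there are at most ε^{-4} = Q^n of them.
  set Q : ℕ := (400 * C) ^ 4 with hQ
  have hQ1 : 1 ≤ Q := Nat.one_le_pow _ _ (by omega)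
  -- The integer frequencies are at most K = (2Q)^{3n} in size: 2^n coordinates, entries up to Q^n,
  -- weights up to (2Q)^{2n}. The factor 4 leaves room for 2K + 1.
  refine ⟨4 * (2 * Q) ^ 3, ?_, fun n hn N hN => ?_⟩
  · have := Nat.one_le_pow 3 (2 * Q) (by omega)
    omega
  obtain ⟨V, _, T, hcard, hsum, hact⟩ := exists_inorderTree n
  have hn1 : (1 : ℝ) ≤ n := by exact_mod_cast hn
  set q : ℝ := (400 * C : ℝ) ^ n with hq
  have hq1 : 1 ≤ q := one_le_pow₀ (by linarith)
  have hq4 : q ^ 4 = ((Q ^ n : ℕ) : ℝ) := by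
    rw [hq, hQ]; push_cast; rw [← pow_mul, ← pow_mul, mul_comm n 4]
  have hε : 0 < q⁻¹ := by positivity
  have hsparse := fun v => exists_sparse_approx (T.factor v) (T.measurable_factor v)
    (T.norm_factor_le v) _ (T.sum_fourierCoeff_factor_le hC v) hε
  choose H hH1 hH2 hH3 using hsparse
  -- the number of coefficients
  have hHcard : ∀ v, (H v).card ≤ Q ^ n := by
    intro v
    have h1 : (H v).card • (q⁻¹ ^ 2) ^ 2 ≤
        ∑ L ∈ H v, ‖∏ a, fourierCoeff (T.factor v a) (L a)‖ ^ 2 :=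
      Finset.card_nsmul_le_sum _ _ _ fun L hL => by
        rw [norm_prod]
        exact pow_le_pow_left₀ (by positivity) (hH1 v L hL) 2
    have h2 := h1.trans (hH2 v)
    rw [T.integral_norm_prod_factor_sq, nsmul_eq_mul] at h2
    have h3 := h2.trans (pow_le_one₀ (by norm_num) (by norm_num))
    rw [← pow_mul, inv_pow, ← div_eq_mul_inv, div_le_one (by positivity), hq4] at h3
    exact_mod_cast h3
  -- the mean of the minorant
  have hη : ∀ v, ∫ θ, ‖∏ a, T.factor v a (θ a) - T.truncation (H v) v θ‖ ^ 2 ∂torusMeasure V ≤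
      ((1 / 20 : ℝ) ^ n) ^ 2 := by
    intro v
    refine (hH3 v).trans ((mul_le_mul_of_nonneg_left (T.prod_ite_anc_le hC1' v) hε.le).trans ?_)
    rw [hq, ← inv_pow, ← mul_pow, ← pow_mul, mul_comm n 2, pow_mul]
    refine pow_le_pow_left₀ (by positivity) (le_of_eq ?_) n
    field_simp
    norm_num
  have hVcard : (Fintype.card V : ℝ) ≤ 2 ^ n := by
    have : Fintype.card V ≤ 2 ^ n := by omega
    exact_mod_cast this
  have hmean : (n : ℝ) / 5 ≤ ∫ θ, T.minorant H θ ∂torusMeasure V := by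
    refine le_trans ?_ (T.le_integral_minorant hsum H (by positivity) hη)
    have h1 : (Fintype.card V : ℝ) * (1 / 20) ^ n ≤ 1 / 10 := by
      calc _ ≤ (2 : ℝ) ^ n * (1 / 20) ^ n := by gcongr
        _ = (1 / 10 : ℝ) ^ n := by rw [← mul_pow]; norm_num
        _ ≤ (1 / 10 : ℝ) ^ 1 := pow_le_pow_of_le_one (by norm_num) (by norm_num) hn
        _ = _ := pow_one _
    have h2 : (n : ℝ) * (3 / 10) ≤ n / Real.pi := by
      rw [div_eq_mul_inv]
      refine mul_le_mul_of_nonneg_left ?_ (by positivity)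
      rw [le_inv_comm₀ (by norm_num) Real.pi_pos]
      have := Real.pi_lt_d2
      norm_num at this ⊢
      linarith
    linarith
  -- the frequencies
  set U : Finset (Σ _ : V, V → ℤ) := Finset.univ.sigma H with hU
  have hUcard : U.card ≤ (2 * Q) ^ n := by
    rw [hU, Finset.card_sigma, mul_pow]
    calc _ ≤ ∑ _v : V, Q ^ n := Finset.sum_le_sum fun v _ => hHcard v
      _ ≤ _ := by
        rw [Finset.sum_const, smul_eq_mul, Finset.card_univ]
        exact Nat.mul_le_mul_right _ (by omega)
  obtain ⟨m, hm, hinj⟩ := exists_injOn_linear (U.image fun p => p.2)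
  have hm' : ∀ v, m v ≤ ((2 * Q) ^ n) ^ 2 := fun v =>
    (hm v).trans (Nat.pow_le_pow_left (Finset.card_image_le.trans hUcard) 2)
  have hne : ∀ p ∈ U, ∏ a, fourierCoeff (T.factor p.1 a) (p.2 a) ≠ 0 := by
    intro p hp h0
    have := hH1 p.1 p.2 (Finset.mem_sigma.1 hp).2
    rw [← norm_prod, h0, norm_zero] at this
    have : 0 < q⁻¹ ^ 2 := by positivity
    linarith
  have hLle : ∀ p ∈ U, ∀ a, |p.2 a| ≤ ((Q ^ n : ℕ) : ℤ) := by
    intro p hp a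
    have h1 := T.abs_le_of_le_prod_fourierCoeff (by positivity)
      (hH1 p.1 p.2 (Finset.mem_sigma.1 hp).2) a
    rw [inv_pow, inv_inv] at h1
    have h2 := h1.trans ((pow_le_pow_right₀ hq1 (by norm_num : 2 ≤ 4)).trans_eq hq4)
    exact_mod_cast h2
  set K : ℕ := ((2 * Q) ^ n) ^ 3 with hK
  have hsize : ∀ p ∈ U, |∑ a, p.2 a * (m a : ℤ)| ≤ (K : ℤ) := by
    intro p hp
    refine (Finset.abs_sum_le_sum_abs _ _).trans ?_
    calc _ ≤ ∑ _a : V, (((Q ^ n : ℕ) : ℤ) * (((2 * Q) ^ n) ^ 2 : ℕ)) := by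
          refine Finset.sum_le_sum fun a _ => ?_
          rw [abs_mul, Nat.abs_cast]
          exact mul_le_mul (hLle p hp a) (by exact_mod_cast hm' a) (by positivity) (by positivity)
      _ ≤ K := by
          rw [Finset.sum_const, nsmul_eq_mul, Finset.card_univ, hK]
          have h1 : Fintype.card V ≤ 2 ^ n := by omega
          have h2 : Fintype.card V * (Q ^ n * ((2 * Q) ^ n) ^ 2) ≤ ((2 * Q) ^ n) ^ 3 := by
            calc _ ≤ 2 ^ n * (Q ^ n * ((2 * Q) ^ n) ^ 2) := Nat.mul_le_mul_right _ h1
              _ = _ := by rw [mul_pow]; ring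
          exact_mod_cast h2
  have hKN : 2 * K + 1 ≤ N := by
    refine le_trans ?_ hN
    have h1 : (4 * (2 * Q) ^ 3) ^ n = 4 ^ n * K := by
      rw [hK, mul_pow, ← pow_mul, ← pow_mul, mul_comm 3 n]
    have h2 : 4 ≤ 4 ^ n := by
      calc 4 = 4 ^ 1 := rfl
        _ ≤ 4 ^ n := Nat.pow_le_pow_right (by norm_num) hn
    have h3 : 1 ≤ K := Nat.one_le_pow _ _ (Nat.pow_pos (by omega))
    rw [h1]
    nlinarith
  obtain ⟨φ, hφ⟩ := exists_phase (T.measurable_minorant H) (T.norm_minorant_le H)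
    (fun v => (m v : ℤ))
  -- The shift by K + 1 moves [-K, K] into [1, 2K + 1]; it multiplies every partial sum by one
  -- unimodular character.
  let κ : (Σ _ : V, V → ℤ) → ℕ := fun p => (∑ a, p.2 a * (m a : ℤ) + (K + 1 : ℤ)).toNat
  have hκ : ∀ p ∈ U, (κ p : ℤ) = ∑ a, p.2 a * (m a : ℤ) + (K + 1 : ℤ) := by
    intro p hp
    have := (abs_le.1 (hsize p hp)).1
    exact Int.toNat_of_nonneg (by linarith)
  have hκinj : Set.InjOn κ U := by
    intro p hp p' hp' h
    have h1 : (κ p : ℤ) = κ p' := by rw [h]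
    rw [hκ p hp, hκ p' hp'] at h1
    have h2 : p.2 = p'.2 := hinj (Finset.mem_image_of_mem _ hp) (Finset.mem_image_of_mem _ hp')
      (add_right_cancel h1)
    have h3 : p.1 = p'.1 := by
      have e := hne p' hp'
      rw [← h2] at e
      exact T.eq_of_prod_fourierCoeff_ne_zero (hne p hp) e
    exact Sigma.ext h3 (heq_of_eq h2)
  set X : Set UnitAddCircle :=
    {x | (n : ℝ) / 10 < T.minorant H (fun v => φ v + (m v : ℤ) • x)}
  have hmeas : Measurable fun x : UnitAddCircle =>
      T.minorant H (fun v => φ v + (m v : ℤ) • x) := by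
    refine (T.measurable_minorant H).comp (measurable_pi_lambda _ fun v => ?_)
    exact (continuous_const.add (continuous_zsmul (m v : ℤ))).measurable
  refine exists_perm_le_weakL2Norm N U κ hκinj (fun p hp => ?_) (fun p => T.rank p.1)
    (fun p => (∏ a, fourierCoeff (T.factor p.1 a) (p.2 a)) * UnitAddTorus.mFourier p.2 φ)
    (D := n) (lam := n / 10) (δ := 1 / 10) (by linarith) ?_ (by linarith) (by norm_num)
    (X := X) ?_ ?_
  · have h1 := abs_le.1 (hsize p hp)
    have h2 := hκ p hp
    rw [Finset.mem_Icc]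
    omega
  · rw [← hsum, hU, Finset.sum_sigma]
    refine Finset.sum_le_sum fun v _ => ?_
    rw [← T.integral_norm_prod_factor_sq]
    refine le_trans (Finset.sum_le_sum fun L _ => ?_) (hH2 v)
    rw [norm_mul]
    refine pow_le_pow_left₀ (by positivity) (mul_le_of_le_one_right (norm_nonneg _) ?_) 2
    exact ((UnitAddTorus.mFourier L).norm_coe_le_norm φ).trans UnitAddTorus.mFourier_norm.le
  · exact le_measure_lt_of_le_integral hmeas
      (Integrable.of_bound hmeas.aestronglyMeasurable _
        (ae_of_all _ fun x => T.norm_minorant_le H _)) (by linarith)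
      (fun x => T.minorant_le hact H _) (hmean.trans hφ)
  · intro x hx
    obtain ⟨t, ht⟩ := T.exists_minorant_le_norm H (fun v => φ v + (m v : ℤ) • x)
    refine ⟨t, lt_of_lt_of_le hx (ht.trans (le_of_eq ?_))⟩
    have hterm : ∀ p ∈ U, (∏ a, fourierCoeff (T.factor p.1 a) (p.2 a)) *
        UnitAddTorus.mFourier p.2 φ * fourier (κ p : ℤ) x = fourier (K + 1 : ℤ) x *
        ((∏ a, fourierCoeff (T.factor p.1 a) (p.2 a)) *
          UnitAddTorus.mFourier p.2 (fun v => φ v + (m v : ℤ) • x)) := by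
      intro p hp
      rw [hκ p hp, fourier_add, mFourier_add_smul]
      ring
    symm
    rw [Finset.sum_congr rfl fun p hp => hterm p (Finset.mem_filter.1 hp).1, Finset.sum_filter, hU,
      Finset.sum_sigma]
    have hv : ∀ v : V, (∑ L ∈ H v, if T.rank v < t then fourier (K + 1 : ℤ) x *
        ((∏ a, fourierCoeff (T.factor v a) (L a)) *
          UnitAddTorus.mFourier L (fun v => φ v + (m v : ℤ) • x)) else 0) =
        fourier (K + 1 : ℤ) x * if T.rank v < t then
          T.truncation (H v) v (fun v => φ v + (m v : ℤ) • x) else 0 := by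
      intro v
      split_ifs
      · rw [InorderTree.truncation, Finset.mul_sum]
      · simp
    rw [Finset.sum_congr rfl fun v _ => hv v, ← Finset.mul_sum, ← Finset.sum_filter, norm_mul,
      fourier_apply, Circle.norm_coe, one_mul]

/-- The weak norm is at least `1 / 2` because of the function `e ^ (2 π i x)`. -/
theorem half_le_weakL2Norm {N : ℕ} (hN : 1 ≤ N) : ∃ σ : Equiv.Perm (Finset.Icc 1 N),
    ENNReal.ofReal (1 / 2) ≤ weakL2Norm (rearrangedMaximal σ) := by
  obtain ⟨σ, hσ⟩ := exists_perm_le_weakL2Norm N {()} (fun _ => 1) (by simp) (by simp [hN])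
    (fun _ => 0) (fun _ => 1) (D := 1) (lam := 1 / 2) (δ := 1) one_pos (by simp) (by norm_num)
    zero_le_one (X := Set.univ) (by simp) (fun x _ => ⟨1, by
      simp [Finset.filter_singleton, fourier_apply, Circle.norm_coe]; norm_num⟩)
  exact ⟨σ, by simpa using hσ⟩

theorem corollary1 :
    ∃ c : ℝ, 0 < c ∧ ∀ N : ℕ, 1 < N →
      ∃ σ : Equiv.Perm (Finset.Icc 1 N),
        ENNReal.ofReal (c * Real.sqrt (Real.log N)) ≤ weakL2Norm (rearrangedMaximal σ) := by
  obtain ⟨B, hB, h⟩ := exists_le_weakL2Norm_of_pow_le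
  have hB1 : (1 : ℝ) < B := by exact_mod_cast hB
  have hlogB : 0 < Real.log B := Real.log_pos hB1
  have hs : 0 < Real.sqrt (2 * Real.log B) := Real.sqrt_pos.2 (by positivity)
  -- Here 1/40 comes from the level √n/10 and √(1/10) ≥ 1/4, while log N ≤ (n + 1) log B ≤ 2n log B
  -- for n ≥ 1. For n = 0, that is N < B, the trivial bound 1/2 is enough.
  refine ⟨1 / 40 / Real.sqrt (2 * Real.log B), by positivity, fun N hN => ?_⟩
  have hN0 : (0 : ℝ) < N := by exact_mod_cast (by omega : 0 < N)
  set n : ℕ := Nat.log B N with hn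
  have hlog : Real.log N ≤ (n + 1) * Real.log B := by
    have h1 : N < B ^ (n + 1) := Nat.lt_pow_succ_log_self (by omega) N
    have h2 : (N : ℝ) ≤ (B : ℝ) ^ (n + 1) := by exact_mod_cast h1.le
    have h3 := Real.log_le_log hN0 h2
    rw [Real.log_pow] at h3
    exact_mod_cast h3
  rcases Nat.eq_zero_or_pos n with h0 | h0
  · obtain ⟨σ, hσ⟩ := half_le_weakL2Norm hN.le
    refine ⟨σ, le_trans (ENNReal.ofReal_le_ofReal ?_) hσ⟩
    rw [h0] at hlog
    have : Real.sqrt (Real.log N) ≤ Real.sqrt (2 * Real.log B) :=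
      Real.sqrt_le_sqrt (by push_cast at hlog; linarith)
    rw [div_mul_eq_mul_div, div_le_iff₀ hs]
    linarith
  · obtain ⟨σ, hσ⟩ := h n h0 N (Nat.pow_log_le_self B (by omega))
    refine ⟨σ, le_trans (ENNReal.ofReal_le_ofReal ?_) hσ⟩
    have hn1 : (1 : ℝ) ≤ n := by exact_mod_cast h0
    have h1 : Real.sqrt (Real.log N) ≤ Real.sqrt n * Real.sqrt (2 * Real.log B) := by
      rw [← Real.sqrt_mul (by positivity)]
      exact Real.sqrt_le_sqrt (by nlinarith)
    have h2 : (1 / 4 : ℝ) ≤ Real.sqrt (1 / 10) := Real.le_sqrt_of_sq_le (by norm_num)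
    have h3 : (n : ℝ) / 10 / Real.sqrt n = Real.sqrt n / 10 := by
      rw [div_right_comm, Real.div_sqrt]
    rw [h3, div_mul_eq_mul_div, div_le_iff₀ hs]
    have h4 : 0 ≤ Real.sqrt n * Real.sqrt (2 * Real.log B) := by positivity
    calc 1 / 40 * Real.sqrt (Real.log N) ≤ 1 / 40 * (Real.sqrt n * Real.sqrt (2 * Real.log B)) := by
          gcongr
      _ = (Real.sqrt n * Real.sqrt (2 * Real.log B)) / 10 * (1 / 4) := by ring
      _ ≤ (Real.sqrt n * Real.sqrt (2 * Real.log B)) / 10 * Real.sqrt (1 / 10) := by gcongr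
      _ = _ := by ring
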